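/- Let $n\ge 2$ and $n\le d\le 2n$ be integers, and let $$R_3(d,n)=\{f\in\mathbb F_3[X_1,\dots,X_n]:\ \deg f\le d,\ \deg_{X_j}f\le 2 \text{ for } 1\le j\le n\}$$ be the ternary Reed–Muller code, where $\deg$ is the total degree and $\deg_{X_j}$ is the degree in $X_j$ (the zero polynomial belongs to $R_3(d,n)$). The weight of $f\in R_3(d,n)$ is its Hamming weight $|f|=3^n-|\{x\in\mathbb F_3^n: f(x)=0\}|$. Then the number of codewords $f\in R_3(d,n)$ whose weight $|f|$ is divisible by $3$ (the zero codeword included) is $$\bigl|\{f\in R_3(d,n):\ 3\mid |f|\}\bigr|=3^{\dim_{\mathbb F_3}R_3(d,n)-1},$$ where $$\dim_{\mathbb F_3}R_3(d,n)=\sum_{0\le j\le\lfloor d/3\rfloor}(-1)^j\binom nj\binom{d-3j+n}{n}.$$ -/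

import Mathlib

/-- The Reed-Muller code `R_q(d, n)` over a finite field `F` with `q` elements: the space of all
polynomials over `F` in `n` variables whose total degree is at most `d` and whose degree in each
variable is at most `q - 1`. -/
noncomputable def reedMuller (F : Type*) [Field F] [Fintype F] (d n : ℕ) :
    Submodule F (MvPolynomial (Fin n) F) :=
  MvPolynomial.restrictTotalDegree (Fin n) F d ⊓
    MvPolynomial.restrictDegree (Fin n) F (Fintype.card F - 1)

theorem mem_reedMuller {F : Type*} [Field F] [Fintype F] {d n : ℕ}
    {f : MvPolynomial (Fin n) F} :
    f ∈ reedMuller F d n ↔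
      f.totalDegree ≤ d ∧ ∀ j, f.degreeOf j ≤ Fintype.card F - 1 := by
  rw [reedMuller, Submodule.mem_inf, MvPolynomial.mem_restrictTotalDegree,
    MvPolynomial.mem_restrictDegree]
  refine and_congr_right fun _ => ⟨fun h j => ?_, fun h s hs j => ?_⟩
  · exact MvPolynomial.degreeOf_le_iff.2 fun s hs => h s hs j
  · exact MvPolynomial.degreeOf_le_iff.1 (h j) s hs

/-- The Hamming weight of a polynomial `f` in `n` variables over a finite field `F`: the Hamming
weight of its evaluation vector `(f(x) : x ∈ F^n)`. -/
noncomputable def codeWeight {F : Type*} [Field F] [Fintype F] [DecidableEq F] {n : ℕ}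
    (f : MvPolynomial (Fin n) F) : ℕ :=
  hammingNorm (fun x : Fin n → F => MvPolynomial.eval x f)

/-- The weight of `f` is `q^n - |Z(f)|`, where `Z(f)` is the zero set of `f` in `F^n`. -/
theorem codeWeight_add_card_zeros {F : Type*} [Field F] [Fintype F] [DecidableEq F] {n : ℕ}
    (f : MvPolynomial (Fin n) F) :
    codeWeight f + Nat.card {x : Fin n → F // MvPolynomial.eval x f = 0} =
      Fintype.card F ^ n := by
  rw [codeWeight, hammingNorm, Nat.card_eq_fintype_card, Fintype.card_subtype, add_comm,
    Finset.card_filter_add_card_filter_not]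
  simp

/-! Nonzero elements of 𝔽₃ square to 1, so `|f|` mod 3 is the quadratic form `∑ f(x)²`. In the basis
of products of `1, X, X² + 1`, the exponent `α` pairs only with its reversal `2 - α`, with value
`(-1)^n`. A basis element whose reversal has degree above `d` lies in the radical. Only `(1, …, 1)`
is its own reversal, and it is available because `n ≤ d`. Up to sign the form is therefore `a² +
q(y)` with `q` a sum of hyperbolic planes, possibly degenerate. Flipping one sign in each plane
negates `q`, which forces exactly one third of all vectors to be zeros (`card_sq_add_eq_zero`). -/

open MvPolynomial in
/-- The basis `1, X, X² + 1` of the univariate polynomials of degree at most two over `𝔽₃`, placed in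
the variable `X i`; its Gram matrix for `(f, g) ↦ ∑ f(t) g(t)` is antidiagonal. -/
noncomputable def hyperbolicFactor {n : ℕ} (i : Fin n) (a : Fin 3) : MvPolynomial (Fin n) (ZMod 3) :=
  ![1, X i, X i ^ 2 + 1] a

/-- The values of `hyperbolicFactor`. -/
def hyperbolicValue (a : Fin 3) (t : ZMod 3) : ZMod 3 := ![1, t, t ^ 2 + 1] a

/-- The products of the `hyperbolicFactor`s over all the variables. -/
noncomputable def hyperbolicPoly {n : ℕ} (α : Fin n → Fin 3) : MvPolynomial (Fin n) (ZMod 3) :=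
  ∏ i, hyperbolicFactor i (α i)

theorem eval_hyperbolicPoly {n : ℕ} (α : Fin n → Fin 3) (x : Fin n → ZMod 3) :
    MvPolynomial.eval x (hyperbolicPoly α) = ∏ i, hyperbolicValue (α i) (x i) := by
  rw [hyperbolicPoly, map_prod]
  refine Finset.prod_congr rfl fun i _ => ?_
  generalize α i = a
  fin_cases a <;> simp [hyperbolicFactor, hyperbolicValue]

theorem totalDegree_hyperbolicFactor_le {n : ℕ} (i : Fin n) (a : Fin 3) :
    (hyperbolicFactor i a).totalDegree ≤ a := by
  fin_cases a
  · simp [hyperbolicFactor]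
  · simp [hyperbolicFactor]
  · exact (MvPolynomial.totalDegree_add _ _).trans (by simp)

theorem degreeOf_hyperbolicFactor_le {n : ℕ} (i j : Fin n) (a : Fin 3) :
    (hyperbolicFactor i a).degreeOf j ≤ if i = j then 2 else 0 := by
  split_ifs with h
  · exact (MvPolynomial.degreeOf_le_totalDegree _ _).trans
      ((totalDegree_hyperbolicFactor_le i a).trans (by omega))
  · fin_cases a
    · simp [hyperbolicFactor]
    · simp [hyperbolicFactor, MvPolynomial.degreeOf_X, Ne.symm h]
    · refine (MvPolynomial.degreeOf_add_le _ _ _).trans ?_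
      have := MvPolynomial.degreeOf_pow_le j (MvPolynomial.X i : MvPolynomial (Fin n) (ZMod 3)) 2
      simp only [MvPolynomial.degreeOf_X, Ne.symm h, if_false, mul_zero] at this
      simpa using this

theorem hyperbolicPoly_mem {n d : ℕ} {α : Fin n → Fin 3} (h : ∑ i, (α i : ℕ) ≤ d) :
    hyperbolicPoly α ∈ reedMuller (ZMod 3) d n := by
  refine mem_reedMuller.2 ⟨?_, fun j => ?_⟩
  · exact (MvPolynomial.totalDegree_finsetProd _ _).trans
      ((Finset.sum_le_sum fun i _ => totalDegree_hyperbolicFactor_le i (α i)).trans h)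
  · refine (MvPolynomial.degreeOf_prod_le _ _ _).trans
      ((Finset.sum_le_sum fun i _ => degreeOf_hyperbolicFactor_le i j (α i)).trans ?_)
    simp [ZMod.card]

theorem sum_hyperbolicValue_mul (a b : Fin 3) :
    ∑ t, hyperbolicValue a t * hyperbolicValue b t = if b = a.rev then -1 else 0 := by
  revert a b; decide

/-- The exponents `2 - α i`. -/
def revExponent {n : ℕ} (α : Fin n → Fin 3) : Fin n → Fin 3 := fun i => (α i).rev

theorem revExponent_involutive {n : ℕ} : Function.Involutive (revExponent (n := n)) :=
  fun α => by ext; simp [revExponent]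

theorem revExponent_eq_self {n : ℕ} {α : Fin n → Fin 3} (h : revExponent α = α) : α = fun _ => 1 := by
  funext i
  have := congrFun h i
  simp only [revExponent] at this
  generalize α i = a at this
  revert this
  revert a
  decide

theorem sum_eval_hyperbolicPoly_mul {n : ℕ} (α β : Fin n → Fin 3) :
    ∑ x, MvPolynomial.eval x (hyperbolicPoly α) * MvPolynomial.eval x (hyperbolicPoly β) =
      if β = revExponent α then (-1 : ZMod 3) ^ n else 0 := by
  simp only [eval_hyperbolicPoly, ← Finset.prod_mul_distrib]
  have := Finset.prod_univ_sum (fun _ : Fin n => (Finset.univ : Finset (ZMod 3)))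
    fun i t => hyperbolicValue (α i) t * hyperbolicValue (β i) t
  rw [Fintype.piFinset_univ] at this
  rw [← this]
  simp only [sum_hyperbolicValue_mul]
  split_ifs with h
  · simp [h, revExponent]
  · obtain ⟨i, hi⟩ := Function.ne_iff.1 h
    exact Finset.prod_eq_zero (Finset.mem_univ i) (if_neg hi)

/-- The exponents of total degree at most `d`. -/
abbrev BoundedExponent (d n : ℕ) := {α : Fin n → Fin 3 // ∑ i, (α i : ℕ) ≤ d}

/-- The polynomial with given coordinates in the family `hyperbolicPoly`. -/
noncomputable def ofCoords (d n : ℕ) :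
    (BoundedExponent d n → ZMod 3) →ₗ[ZMod 3] MvPolynomial (Fin n) (ZMod 3) :=
  Fintype.linearCombination (ZMod 3) fun α => hyperbolicPoly α.1

theorem eval_ofCoords {d n : ℕ} (c : BoundedExponent d n → ZMod 3) (x : Fin n → ZMod 3) :
    MvPolynomial.eval x (ofCoords d n c) = ∑ α, c α * MvPolynomial.eval x (hyperbolicPoly α.1) := by
  simp [ofCoords, Fintype.linearCombination_apply, map_sum, MvPolynomial.smul_eval]

theorem sum_eval_ofCoords_mul {d n : ℕ} (c : BoundedExponent d n → ZMod 3) (β : Fin n → Fin 3) :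
    ∑ x, MvPolynomial.eval x (ofCoords d n c) * MvPolynomial.eval x (hyperbolicPoly β) =
      (-1 : ZMod 3) ^ n * ∑ α, if β = revExponent α.1 then c α else 0 := by
  simp only [eval_ofCoords, Finset.sum_mul, mul_assoc]
  rw [Finset.sum_comm]
  simp only [← Finset.mul_sum, sum_eval_hyperbolicPoly_mul]
  rw [Finset.mul_sum]
  refine Finset.sum_congr rfl fun α _ => ?_
  split_ifs <;> ring

/-- Pairing with the reversed basis polynomial isolates a coefficient, even when that polynomial
lies outside the code. -/
theorem ofCoords_injective (d n : ℕ) : Function.Injective (ofCoords d n) := by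
  rw [injective_iff_map_eq_zero]
  intro c hc
  funext β
  have h := sum_eval_ofCoords_mul c (revExponent β.1)
  simpa [hc, revExponent_involutive.injective.eq_iff, ← Subtype.ext_iff] using h

theorem finrank_reedMuller (d n : ℕ) :
    Module.finrank (ZMod 3) (reedMuller (ZMod 3) d n) = Fintype.card (BoundedExponent d n) ∧
      Module.Finite (ZMod 3) (reedMuller (ZMod 3) d n) := by
  have h : reedMuller (ZMod 3) d n = MvPolynomial.restrictSupport (ZMod 3)
      {s | (s.sum fun _ e => e) ≤ d ∧ ∀ i, s i ≤ 2} := by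
    ext f
    simp only [reedMuller, Submodule.mem_inf, MvPolynomial.restrictTotalDegree,
      MvPolynomial.restrictDegree, MvPolynomial.mem_restrictSupport_iff, ← Set.subset_inter_iff,
      ZMod.card]
    rfl
  have e : {s : Fin n →₀ ℕ | (s.sum fun _ e => e) ≤ d ∧ ∀ i, s i ≤ 2} ≃ BoundedExponent d n :=
    { toFun := fun s => ⟨fun i => ⟨s.1 i, Nat.lt_succ_of_le (s.2.2 i)⟩, by
        have := s.2.1
        rwa [Finsupp.sum_fintype _ _ fun _ => rfl] at this⟩
      invFun := fun α => ⟨Finsupp.equivFunOnFinite.symm fun i => (α.1 i : ℕ), by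
        refine ⟨?_, fun i => Nat.le_of_lt_succ (α.1 i).2⟩
        rw [Finsupp.sum_fintype _ _ fun _ => rfl]
        exact α.2⟩
      left_inv := fun s => by ext; rfl
      right_inv := fun α => by ext; rfl }
  rw [h]
  have b := (MvPolynomial.basisRestrictSupport (ZMod 3)
    {s : Fin n →₀ ℕ | (s.sum fun _ e => e) ≤ d ∧ ∀ i, s i ≤ 2}).reindex e
  exact ⟨Module.finrank_eq_card_basis b, Module.Finite.of_basis b⟩

theorem range_ofCoords (d n : ℕ) : LinearMap.range (ofCoords d n) = reedMuller (ZMod 3) d n := by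
  obtain ⟨h, _⟩ := finrank_reedMuller d n
  refine Submodule.eq_of_le_of_finrank_eq ?_ ?_
  · rintro _ ⟨c, rfl⟩
    rw [ofCoords, Fintype.linearCombination_apply]
    exact Submodule.sum_mem _ fun α _ => Submodule.smul_mem _ _ (hyperbolicPoly_mem α.2)
  · rw [LinearMap.finrank_range_of_inj (ofCoords_injective d n), h, Module.finrank_fintype_fun_eq_card]

/-! ### The weight modulo 3 as a quadratic form -/

theorem natCast_codeWeight {n : ℕ} (f : MvPolynomial (Fin n) (ZMod 3)) :
    (codeWeight f : ZMod 3) = ∑ x, MvPolynomial.eval x f * MvPolynomial.eval x f := by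
  rw [codeWeight, hammingNorm, Finset.card_filter, Nat.cast_sum]
  refine Finset.sum_congr rfl fun x _ => ?_
  generalize MvPolynomial.eval x f = t
  revert t
  decide

theorem three_dvd_codeWeight_ofCoords {d n : ℕ} (c : BoundedExponent d n → ZMod 3) :
    3 ∣ codeWeight (ofCoords d n c) ↔
      ∑ β, ∑ α, (if β.1 = revExponent α.1 then c β * c α else 0) = 0 := by
  have h : (codeWeight (ofCoords d n c) : ZMod 3) = (-1 : ZMod 3) ^ n *
      ∑ β, ∑ α, (if β.1 = revExponent α.1 then c β * c α else 0) := by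
    rw [natCast_codeWeight]
    calc _ = ∑ β, c β * ∑ x, MvPolynomial.eval x (ofCoords d n c) *
          MvPolynomial.eval x (hyperbolicPoly β.1) := by
          simp only [Finset.mul_sum]
          rw [Finset.sum_comm]
          refine Finset.sum_congr rfl fun x _ => ?_
          conv_lhs =>
            enter [1]
            rw [eval_ofCoords]
          rw [Finset.sum_mul]
          refine Finset.sum_congr rfl fun β _ => ?_
          ring
      _ = _ := by
          simp only [sum_eval_ofCoords_mul, Finset.mul_sum]
          refine Finset.sum_congr rfl fun β _ => Finset.sum_congr rfl fun α _ => ?_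
          split_ifs <;> ring
  rw [← ZMod.natCast_eq_zero_iff, h]
  simp

/-! ### Counting the zeros of the form -/

/-- If `q` takes opposite values under a bijection, then `a² + q(y)` has as many zeros as it would
have on average. -/
theorem card_sq_add_eq_zero {Y : Type*} [Fintype Y] (q : Y → ZMod 3) (σ : Y ≃ Y)
    (hσ : ∀ y, q (σ y) = -q y) :
    Nat.card {p : ZMod 3 × Y // p.1 ^ 2 + q p.2 = 0} = Fintype.card Y := by
  classical
  -- For `t = 0, 1, -1` there are 1, 0, 2 roots. The deviation from 1 is odd in `t`, so it cancels
  -- under `σ`.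
  have hc : ∀ t : ZMod 3, ∑ a : ZMod 3, (if a ^ 2 + t = 0 then (1 : ℤ) else 0) =
      1 - t.valMinAbs := by decide
  have hneg : ∀ t : ZMod 3, (-t).valMinAbs = -t.valMinAbs := by decide
  have h0 : ∑ y, (q y).valMinAbs = 0 := by
    have := Equiv.sum_comp σ fun y => (q y).valMinAbs
    simp only [hσ, hneg, Finset.sum_neg_distrib] at this
    omega
  rw [Nat.card_eq_fintype_card, Fintype.card_subtype, Finset.card_filter]
  zify
  rw [Fintype.sum_prod_type_right]
  simp only [hc, Finset.sum_sub_distrib, h0]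
  simp

/-- Any enumeration of `E` orders each two-element orbit; the smaller element gets sign 1, the
larger -1. -/
theorem exists_antisymmetric_sign {E : Type*} [Finite E] (r : E → E) (hr : Function.Involutive r) :
    ∃ ε : E → ZMod 3, (∀ e, ε e * ε e = 1) ∧ ∀ e, r e ≠ e → ε (r e) * ε e = -1 := by
  obtain ⟨m, ⟨u⟩⟩ := Finite.exists_equiv_fin E
  refine ⟨fun e => if u e < u (r e) then 1 else -1, fun e => by
    dsimp only
    split_ifs <;> simp, fun e he => ?_⟩
  have hne : u (r e) ≠ u e := fun h => he (u.injective h)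
  simp only [hr e]
  rcases lt_or_gt_of_ne hne with h | h <;> simp [h, h.not_gt]

theorem ncard_three_dvd_codeWeight {n d : ℕ} (hnd : n ≤ d) :
    Set.ncard {f : MvPolynomial (Fin n) (ZMod 3) |
        f ∈ reedMuller (ZMod 3) d n ∧ 3 ∣ codeWeight f} =
      3 ^ (Fintype.card (BoundedExponent d n) - 1) := by
  classical
  let o : BoundedExponent d n := ⟨fun _ => 1, by simpa using hnd⟩
  have ho : ∀ α : BoundedExponent d n, o.1 = revExponent α.1 ↔ α = o := fun α => by
    rw [Subtype.ext_iff]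
    constructor
    · intro h
      rw [← revExponent_involutive α.1, ← h]
      rfl
    · rintro h
      rw [h]
      rfl
  have himage : {f : MvPolynomial (Fin n) (ZMod 3) |
      f ∈ reedMuller (ZMod 3) d n ∧ 3 ∣ codeWeight f} =
      ofCoords d n '' {c | ∑ β, ∑ α, (if β.1 = revExponent α.1 then c β * c α else 0) = 0} := by
    ext f
    simp only [Set.mem_ofPred_eq, Set.mem_image, ← range_ofCoords, LinearMap.mem_range]
    constructor
    · rintro ⟨⟨c, rfl⟩, h⟩
      exact ⟨c, (three_dvd_codeWeight_ofCoords c).1 h, rfl⟩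
    · rintro ⟨c, h, rfl⟩
      exact ⟨⟨c, rfl⟩, (three_dvd_codeWeight_ofCoords c).2 h⟩
  -- The form on the coordinates other than the self-paired one `o`.
  let q : ({α : BoundedExponent d n // α ≠ o} → ZMod 3) → ZMod 3 := fun y =>
    ∑ β, ∑ α, if β.1.1 = revExponent α.1.1 then y β * y α else 0
  obtain ⟨ε, hε, hε'⟩ := exists_antisymmetric_sign _ (revExponent_involutive (n := n))
  have hinv : Function.Involutive fun (y : {α : BoundedExponent d n // α ≠ o} → ZMod 3) α =>
      ε α.1.1 * y α := fun y => by
    funext α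
    simp only [← mul_assoc, hε, one_mul]
  have hσ : ∀ y, q (hinv.toPerm _ y) = -q y := fun y => by
    simp only [q, ← Finset.sum_neg_distrib, Function.Involutive.coe_toPerm]
    refine Finset.sum_congr rfl fun β _ => Finset.sum_congr rfl fun α _ => ?_
    split_ifs with h
    · rw [h, mul_mul_mul_comm, hε' _ fun h' => α.2 (Subtype.ext (revExponent_eq_self h'))]
      ring
    · simp
  have hq : ∀ c : BoundedExponent d n → ZMod 3,
      ∑ β, ∑ α, (if β.1 = revExponent α.1 then c β * c α else 0) =
        c o ^ 2 + q fun α => c α.1 := fun c => by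
    have ho' : ∀ β : BoundedExponent d n, β.1 = revExponent o.1 ↔ β = o := fun β =>
      (Subtype.ext_iff (a1 := β) (a2 := o)).symm
    have hsplit : ∀ g : BoundedExponent d n → ZMod 3,
        ∑ α, g α = g o + ∑ α : {α // α ≠ o}, g α.1 := fun g => by
      rw [Fintype.sum_eq_add_sum_subtype_ne g o]
    rw [hsplit]
    simp only [ho, Finset.sum_ite_eq', Finset.mem_univ, if_true]
    rw [sq]
    congr 1
    refine Finset.sum_congr rfl fun β _ => ?_
    rw [hsplit, if_neg (mt (ho' _).1 β.2), zero_add]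
  rw [himage, Set.ncard_image_of_injective _ (ofCoords_injective d n), ← Nat.card_coe_set_eq]
  have e : {c : BoundedExponent d n → ZMod 3 |
      ∑ β, ∑ α, (if β.1 = revExponent α.1 then c β * c α else 0) = 0} ≃
      {p : ZMod 3 × ({α : BoundedExponent d n // α ≠ o} → ZMod 3) // p.1 ^ 2 + q p.2 = 0} :=
    (Equiv.funSplitAt o (ZMod 3)).subtypeEquiv fun c => by
      simp only [Set.mem_ofPred_eq, hq]
      rfl
  rw [Nat.card_congr e, card_sq_add_eq_zero q _ hσ]
  simp [Fintype.card_subtype_compl, ZMod.card]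

/-! ### The dimension by generating functions -/

open PowerSeries in
theorem coeff_X_pow_mul_mk_one (k d : ℕ) :
    coeff d ((X : ℤ⟦X⟧) ^ k * PowerSeries.mk 1) = if k ≤ d then 1 else 0 := by
  rw [coeff_X_pow_mul']
  simp

open PowerSeries in
-- Multiplying by `1/(1 - X)` sums the coefficients up to degree `d`.
theorem card_boundedExponent_eq_coeff (d n : ℕ) :
    (Fintype.card (BoundedExponent d n) : ℤ) =
      coeff d ((1 + X + X ^ 2 : ℤ⟦X⟧) ^ n * PowerSeries.mk 1) := by
  have h : (1 + X + X ^ 2 : ℤ⟦X⟧) ^ n = ∑ α : Fin n → Fin 3, X ^ ∑ i, (α i : ℕ) := by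
    have := Finset.prod_univ_sum (fun _ : Fin n => (Finset.univ : Finset (Fin 3)))
      fun _ a => (X : ℤ⟦X⟧) ^ (a : ℕ)
    rw [Fintype.piFinset_univ] at this
    simp only [Finset.prod_pow_eq_pow_sum] at this
    rw [← this]
    simp [Fin.sum_univ_three]
  rw [h, Finset.sum_mul, map_sum, Fintype.card_subtype, Finset.card_filter]
  simp [coeff_X_pow_mul_mk_one]

open PowerSeries in
theorem card_boundedExponent_eq_sum (d n : ℕ) :
    (Fintype.card (BoundedExponent d n) : ℤ) = ∑ j ∈ Finset.range (d / 3 + 1),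
        (-1 : ℤ) ^ j * (n.choose j : ℤ) * ((d - 3 * j + n).choose n : ℤ) := by
  have h1 : (1 + X + X ^ 2 : ℤ⟦X⟧) = (1 - X ^ 3) * PowerSeries.mk 1 := by
    have := mk_one_mul_one_sub_eq_one ℤ
    linear_combination (-(1 + X + X ^ 2 : ℤ⟦X⟧)) * this
  have h2 : (1 - X ^ 3 : ℤ⟦X⟧) ^ n =
      ∑ j ∈ Finset.range (n + 1), C ((-1 : ℤ) ^ j * (n.choose j : ℤ)) * X ^ (3 * j) := by
    rw [sub_eq_add_neg, add_comm, add_pow]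
    refine Finset.sum_congr rfl fun j _ => ?_
    rw [neg_pow, one_pow, pow_mul]
    simp
    ring
  rw [card_boundedExponent_eq_coeff, h1, mul_pow, mul_assoc, ← pow_succ,
    mk_one_pow_eq_mk_choose_add, h2, Finset.sum_mul, map_sum]
  simp only [mul_assoc, coeff_C_mul, coeff_X_pow_mul', coeff_mk]
  have hl : Finset.range (n + 1) ⊆ Finset.range (n + d + 1) :=
    Finset.range_subset_range.2 (by omega)
  have hr : Finset.range (d / 3 + 1) ⊆ Finset.range (n + d + 1) :=
    Finset.range_subset_range.2 (by omega)
  -- Both sums extend to a common range: `n.choose j` vanishes for `j > n`, and the shift by `X ^ (3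
  -- * j)` kills `3 * j > d`.
  rw [Finset.sum_subset hl fun j _ hj => by
      rw [Nat.choose_eq_zero_of_lt (by simpa using hj)]; simp,
    ← Finset.sum_subset hr fun j _ hj => by
      rw [if_neg (by simp at hj; omega)]; simp]
  refine Finset.sum_congr rfl fun j hj => ?_
  rw [if_pos (by simp at hj; omega), add_comm n]

theorem corollary3p11 (n d : ℕ) (hn : 2 ≤ n) (hnd : n ≤ d) (hd : d ≤ 2 * n) :
    Set.ncard {f : MvPolynomial (Fin n) (ZMod 3) |
        f ∈ reedMuller (ZMod 3) d n ∧ 3 ∣ codeWeight f} =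
      3 ^ (Module.finrank (ZMod 3) (reedMuller (ZMod 3) d n) - 1) ∧
    (Module.finrank (ZMod 3) (reedMuller (ZMod 3) d n) : ℤ) =
      ∑ j ∈ Finset.range (d / 3 + 1),
        (-1 : ℤ) ^ j * (n.choose j : ℤ) * ((d - 3 * j + n).choose n : ℤ) := by
  rw [(finrank_reedMuller d n).1]
  exact ⟨ncard_three_dvd_codeWeight hnd, card_boundedExponent_eq_sum d n⟩
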